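/- Let $\Phi$ be a finite reduced crystallographic root system with a fixed base of simple roots, let $W$ be its Weyl group, $\ell$ the length function on $W$ with respect to the simple reflections, and $T=\{wsw^{-1} : w\in W,\ s \text{ a simple reflection}\}$ the set of reflections. For $\tau\in T$ let $\alpha$ denote the positive root corresponding to $\tau$, and let $\mathrm{ht}(\alpha)$ be its height, the sum of its coefficients in the simple roots. Let $k$ be a field of characteristic $0$, and let $E$ be a multiplicative $k$-valued function on the set of positive roots, that is, $E(\alpha+\beta)=E(\alpha)E(\beta)$ whenever $\alpha$, $\beta$ and $\alpha+\beta$ are positive roots (the value $0$ is allowed). For $\tau\in T$ let the quantum Bruhat operator $Q_\tau$ be the $k$-linear operator on the group algebra $k[W]$ given, for $w\in W$, by $$Q_\tau(w)=\begin{cases}\tau w & \text{if } \ell(\tau w)=\ell(w)+1,\\ E(\alpha)\,\tau w & \text{if } \ell(\tau w)=\ell(w)-\ell(\tau)\ \text{and}\ \ell(\tau)=2\,\mathrm{ht}(\alpha)-1,\\ 0 & \text{otherwise.}\end{cases}$$ Then for every $\varepsilon\in k$ the operators $R_\tau=1+\varepsilon Q_\tau$, $\tau\in T$, satisfy the Yang–Baxter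 equations for $W$: for every dihedral reflection subgroup $W'$ of $W$ with canonical generators $a$ and $b$, $$R_a\,R_{aba}\,R_{ababa}\cdots R_{bab}\,R_b \;=\; R_b\,R_{bab}\cdots R_{ababa}\,R_{aba}\,R_a .$$ Here a reflection subgroup is a subgroup $W'$ of $W$ generated by a subset of $T$; its canonical generators are the reflections in the simple roots of the root subsystem $\{\alpha\in\Phi : s_\alpha\in W'\}$, whose positive roots are those that are positive in $\Phi$; and $W'$ is dihedral if it has exactly two canonical generators. The product on the left runs over the reflections $(ab)^j a$, $0\le j<m$, where $m$ is the order of $ab$, and the product on the right is the same product in reverse order. -/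

import Mathlib

noncomputable section

namespace QuantumBruhat

open RootPairing

section Weyl

variable {ι R M N : Type*} [CommRing R] [AddCommGroup M] [Module R M]
  [AddCommGroup N] [Module R N] {P : RootPairing ι R M N}

/-- The simple reflections of the Weyl group, relative to a base of the root system. -/
def simpleReflections (b : P.Base) : Set P.weylGroup :=
  weylGroup.ofIdx P '' (b.support : Set ι)

/-- The length `ℓ(w)`: the least `l` such that `w` is a product of `l` simple reflections. -/
def length (b : P.Base) (w : P.weylGroup) : ℕ :=
  sInf {l | ∃ s : List P.weylGroup, (∀ x ∈ s, x ∈ simpleReflections b) ∧ s.prod = w ∧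
    s.length = l}

/-- The set `T` of reflections of the Weyl group: all conjugates of simple reflections. -/
def reflections (b : P.Base) : Set P.weylGroup :=
  {t | ∃ w : P.weylGroup, ∃ s ∈ simpleReflections b, t = w * s * w⁻¹}

lemma conj_mem_reflections (b : P.Base) {t : P.weylGroup} (ht : t ∈ reflections b)
    (u : P.weylGroup) : u * t * u⁻¹ ∈ reflections b := by
  obtain ⟨w, s, hs, rfl⟩ := ht
  exact ⟨u * w, s, hs, by group⟩

lemma ofIdx_mul_self (i : ι) : weylGroup.ofIdx P i * weylGroup.ofIdx P i = 1 := by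
  rw [mul_eq_one_iff_eq_inv]
  exact Subtype.ext (Equiv.reflection_inv P i).symm

lemma mul_self_of_mem_reflections (b : P.Base) {t : P.weylGroup} (ht : t ∈ reflections b) :
    t * t = 1 := by
  obtain ⟨w, s, ⟨i, -, rfl⟩, rfl⟩ := ht
  have h := ofIdx_mul_self (P := P) i
  calc w * weylGroup.ofIdx P i * w⁻¹ * (w * weylGroup.ofIdx P i * w⁻¹)
      = w * (weylGroup.ofIdx P i * weylGroup.ofIdx P i) * w⁻¹ := by group
    _ = 1 := by rw [h]; group

/-- The alternating words `a, aba, ababa, …` are reflections; `(ab)ʲa` has length `2j + 1`. -/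
lemma alternating_mem_reflections (b : P.Base) {x y : P.weylGroup} (hx : x ∈ reflections b)
    (hy : y ∈ reflections b) (j : ℕ) : (x * y) ^ j * x ∈ reflections b := by
  induction j generalizing x y with
  | zero => simpa using hx
  | succ j ih =>
    have h := conj_mem_reflections b (ih hy hx) x
    have hxi : x⁻¹ = x := inv_eq_of_mul_eq_one_left (mul_self_of_mem_reflections b hx)
    have e : x * ((y * x) ^ j * y) * x⁻¹ = (x * y) ^ (j + 1) * x := by
      rw [hxi]
      clear ih h hxi hx hy
      have : ∀ n : ℕ, x * (y * x) ^ n = (x * y) ^ n * x := by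
        intro n
        induction n with
        | zero => simp
        | succ n ihn => rw [pow_succ, ← mul_assoc, ihn, pow_succ]; group
      rw [← mul_assoc, this, pow_succ]
      group
    rwa [e] at h

lemma conj_ofIdx (w : P.weylGroup) (i : ι) :
    w * weylGroup.ofIdx P i * w⁻¹ = weylGroup.ofIdx P (P.weylGroupToPerm w i) := by
  obtain ⟨w, hw⟩ := w
  induction hw using weylGroup.induction generalizing i with
  | mem j =>
    apply Subtype.ext
    apply Equiv.weightHom_injective P
    have h : (Equiv.weightHom P) (Equiv.reflection P j) = P.reflection j :=
      Equiv.reflection_weightEquiv P j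
    have h' : (Equiv.weightHom P) (Equiv.reflection P i) = P.reflection i :=
      Equiv.reflection_weightEquiv P i
    have h'' : (Equiv.weightHom P) (Equiv.reflection P (P.reflectionPerm j i)) =
        P.reflection (P.reflectionPerm j i) := Equiv.reflection_weightEquiv P _
    change (Equiv.weightHom P) (Equiv.reflection P j * Equiv.reflection P i *
      (Equiv.reflection P j)⁻¹) = (Equiv.weightHom P)
        (Equiv.reflection P (P.reflectionPerm j i))
    rw [Equiv.reflection_inv, map_mul, map_mul, h, h', h'', P.reflection_reflectionPerm]
  | one =>
    have : (⟨1, one_mem _⟩ : P.weylGroup) = 1 := rfl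
    rw [this]; simp
  | mul x y hx hy ihx ihy =>
    have : (⟨x * y, mul_mem hx hy⟩ : P.weylGroup) = ⟨x, hx⟩ * ⟨y, hy⟩ := rfl
    rw [this, map_mul, Equiv.Perm.mul_apply, ← ihx, ← ihy]
    group

variable [CharZero R]

/-- Every reflection is the reflection in some positive root. -/
lemma exists_posRoot (b : P.Base) {t : P.weylGroup} (ht : t ∈ reflections b) :
    ∃ i, b.IsPos i ∧ weylGroup.ofIdx P i = t := by
  obtain ⟨w, s, ⟨i, -, rfl⟩, rfl⟩ := ht
  rw [conj_ofIdx]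
  generalize P.weylGroupToPerm w i = k
  let := P.indexNeg
  rcases Base.IsPos.or_neg b k with h | h
  · exact ⟨k, h, rfl⟩
  · refine ⟨-k, h, ?_⟩
    apply Subtype.ext
    apply Equiv.weightHom_injective P
    have h1 : (Equiv.weightHom P) (Equiv.reflection P k) = P.reflection k :=
      Equiv.reflection_weightEquiv P k
    have h2 : (Equiv.weightHom P) (Equiv.reflection P (-k)) = P.reflection (-k) :=
      Equiv.reflection_weightEquiv P _
    change (Equiv.weightHom P) (Equiv.reflection P (-k)) =
      (Equiv.weightHom P) (Equiv.reflection P k)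
    rw [h1, h2]
    ext x
    simp [P.reflection_apply]
    module

/-- The positive root corresponding to a reflection. -/
def posRoot (b : P.Base) (t : reflections b) : {i : ι // b.IsPos i} :=
  ⟨(exists_posRoot b t.2).choose, (exists_posRoot b t.2).choose_spec.1⟩

lemma ofIdx_posRoot (b : P.Base) (t : reflections b) :
    weylGroup.ofIdx P (posRoot b t).1 = t :=
  (exists_posRoot b t.2).choose_spec.2

/-- For a reduced root system the positive root corresponding to a reflection is unique. -/
lemma posRoot_eq [IsDomain R] [Module.IsTorsionFree R M] [P.IsReduced] (b : P.Base)
    (t : reflections b) {i : ι} (hi : b.IsPos i) (h : weylGroup.ofIdx P i = t) :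
    (posRoot b t).1 = i := by
  have hj := (posRoot b t).2
  have h' := (ofIdx_posRoot b t).trans h.symm
  generalize (posRoot b t).1 = j at hj h'
  have e : P.reflection j (P.root j) = P.reflection i (P.root j) :=
    congrArg (fun g : P.weylGroup => g • P.root j) h'
  rw [P.reflection_apply_self, P.reflection_apply_root] at e
  have hdep : ¬ LinearIndependent R ![P.root j, P.root i] := by
    intro hl
    have := (LinearIndependent.pair_iff.mp hl) 2 (-(P.pairing j i)) (by
      rw [two_smul, neg_smul, ← sub_eq_add_neg, add_sub_assoc, ← e]
      simp)
    simp at this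
  rcases IsReduced.eq_or_eq_neg j i hdep with hr | hr
  · exact P.root.injective hr
  · exfalso
    let := P.indexNeg
    have hji : j = -i := P.root.injective (by simp [hr])
    rw [hji] at hj
    exact (Base.IsPos.neg_iff_not b i).mp hj hi

/-- The positive roots of the root subsystem attached to a subgroup `W'` of the Weyl group:
those positive roots whose reflection lies in `W'`. -/
def positiveSubsystem (b : P.Base) (W' : Subgroup P.weylGroup) : Set ι :=
  {i | b.IsPos i ∧ weylGroup.ofIdx P i ∈ W'}

/-- The canonical generators of a reflection subgroup `W'`: the reflections in the simple roots of
its root subsystem, that is, in those positive roots of the subsystem which are not the sum of two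
positive roots of the subsystem. -/
def canonicalGenerators (b : P.Base) (W' : Subgroup P.weylGroup) : Set P.weylGroup :=
  weylGroup.ofIdx P '' {i ∈ positiveSubsystem b W' |
    ∀ j ∈ positiveSubsystem b W', ∀ k ∈ positiveSubsystem b W', P.root i ≠ P.root j + P.root k}

/-- A reflection subgroup: a subgroup generated by a set of reflections. -/
def IsReflectionSubgroup (b : P.Base) (W' : Subgroup P.weylGroup) : Prop :=
  ∃ A ⊆ reflections b, W' = Subgroup.closure A

/-- `W'` is a dihedral reflection subgroup whose two canonical generators are `x` and `y`. -/
def IsDihedralWithGenerators (b : P.Base) (W' : Subgroup P.weylGroup) (x y : P.weylGroup) : Prop :=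
  IsReflectionSubgroup b W' ∧ x ≠ y ∧ canonicalGenerators b W' = {x, y}

/-- The sequence of reflections `x, xyx, xyxyx, …, yxy, y`: its terms are `(xy)ʲx` for
`0 ≤ j < m`, where `m` is the order of `xy`. -/
def reflectionSequence (b : P.Base) (x y : reflections b) : List (reflections b) :=
  (List.range (orderOf ((x : P.weylGroup) * y))).map fun j =>
    ⟨((x : P.weylGroup) * y) ^ j * x, alternating_mem_reflections b x.2 y.2 j⟩

/-- A family of elements of a monoid, indexed by the reflections, satisfies the Yang--Baxter
equations: for every dihedral reflection subgroup with canonical generators `x` and `y`,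
`R_x R_{xyx} R_{xyxyx} ⋯ R_{yxy} R_y = R_y R_{yxy} ⋯ R_{xyxyx} R_{xyx} R_x`. -/
def IsYangBaxterSolution (b : P.Base) {A : Type*} [Monoid A] (r : reflections b → A) : Prop :=
  ∀ (W' : Subgroup P.weylGroup) (x y : reflections b), IsDihedralWithGenerators b W' x y →
    ((reflectionSequence b x y).map r).prod = ((reflectionSequence b x y).map r).reverse.prod

/-- A scalar function on the positive roots is multiplicative if `E(α + β) = E(α) E(β)` whenever
`α`, `β` and `α + β` are positive roots. -/
def IsMultiplicative (b : P.Base) {k : Type*} [Mul k] (E : {i : ι // b.IsPos i} → k) : Prop :=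
  ∀ α β γ : {i : ι // b.IsPos i}, P.root γ.1 = P.root α.1 + P.root β.1 → E γ = E α * E β

variable {k : Type*} [Field k]

open Classical in
/-- The scalar by which the quantum Bruhat operator of `τ` multiplies `τw` in the image of `w`. -/
def quantumBruhatCoeff (b : P.Base) (E : {i : ι // b.IsPos i} → k) (τ : reflections b)
    (w : P.weylGroup) : k :=
  if length b (τ * w) = length b w + 1 then 1
  else if length b (τ * w) + length b (τ : P.weylGroup) = length b w ∧
    (length b (τ : P.weylGroup) : ℤ) = 2 * b.height (posRoot b τ).1 - 1 then E (posRoot b τ)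
  else 0

/-- The quantum Bruhat operator `Q_τ` on the group algebra `k[W]`: the linear operator sending each
`w` in `W` to `quantumBruhatCoeff b E τ w` times `τw`. -/
def quantumBruhat (b : P.Base) (E : {i : ι // b.IsPos i} → k) (τ : reflections b) :
    Module.End k (MonoidAlgebra k P.weylGroup) :=
  (Finsupp.linearCombination k fun w : P.weylGroup =>
      MonoidAlgebra.single ((τ : P.weylGroup) * w) (quantumBruhatCoeff b E τ w)) ∘ₗ
    (MonoidAlgebra.coeffLinearEquiv k).toLinearMap

lemma quantumBruhat_single (b : P.Base) (E : {i : ι // b.IsPos i} → k) (τ : reflections b)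
    (w : P.weylGroup) :
    quantumBruhat b E τ (MonoidAlgebra.single w 1) =
      quantumBruhatCoeff b E τ w • MonoidAlgebra.single ((τ : P.weylGroup) * w) 1 := by
  simp [quantumBruhat]

end Weyl

end QuantumBruhat

end

noncomputable section

namespace QuantumBruhat

open RootPairing

/-! ### Lengths, strong exchange, and the length of a reflection. -/

section RootSystem

variable {ι R M N : Type*} [Field R] [AddCommGroup M] [Module R M]
  [AddCommGroup N] [Module R N] {P : RootPairing ι R M N}

/-! The operators `1 + ε Q_τ` are a degeneration of mixed Bruhat operators. For parameters `c`, `d`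
and a weight `e`, the operator `mixedBruhatOp` of a positive root α factors as s_α · ((1 - e) H_α +
d e), where the Hecke operator H_α satisfies H² = d H + c² (`mixedBruhatOp_eq`, `heckeOp_mul_self`).
Conjugation by a Weyl group element u carries the operator of α to that of uα. Hence the product
along the reflection sequence of two roots α_i, α_j telescopes to an alternating group element times
a product of spectral factors in H_i and H_j alone (`mixedBruhatProd_eq`). The group element is the
same for both orders. What remains is a Yang–Baxter identity with spectral parameters between two
elements satisfying quadratic and braid relations. For multiplicative weights it is checked in types
A₁×A₁, A₂, B₂ and G₂. These types suffice because canonical generators come from indecomposable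
roots, which pair non-positively.

The roots α_i, α_j need not be simple in Φ, so the braid relation is proved directly, by descending
induction on length (`heckeProd_braid`).

For the degeneration, work over k[t] with c = t, d = ε and weights E(α) t^(2 ht α), again
multiplicative because height is additive. Conjugating by w ↦ t^ℓ(w) w and dividing by t gives
`deformedOp`, whose coefficients at s_α w are ε t^(ℓ(s_α w) - ℓ(w) - 1) or ε E(α) t^(2 ht α + ℓ(s_α
w) - ℓ(w) - 1). The second exponent is non-negative because ℓ(s_α) ≤ 2 ht α - 1. At t = 0 only
exponent zero survives, which gives exactly the two nonzero cases of Q_τ (`eval_deformedCoeff`). The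
powers of t are cancelled over k[t], before specializing. -/

lemma root_smul (w : P.weylGroup) (i : ι) : P.root (w • i) = w • P.root i :=
  (weylGroup_apply_root P w i).symm

lemma ofIdx_smul_index (i j : ι) : weylGroup.ofIdx P i • j = P.reflectionPerm i j :=
  congrArg (fun e : ι ≃ ι => e j) (Equiv.reflection_indexEquiv P i)

lemma ofIdx_smul_root (i j : ι) :
    P.root (weylGroup.ofIdx P i • j) = P.root j - P.pairing j i • P.root i := by
  rw [ofIdx_smul_index, root_reflectionPerm, reflection_apply_root]

lemma ofIdx_smul_eq_conj (w : P.weylGroup) (i : ι) :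
    weylGroup.ofIdx P (w • i) = w * weylGroup.ofIdx P i * w⁻¹ :=
  (conj_ofIdx w i).symm

lemma ofIdx_inv (i : ι) : (weylGroup.ofIdx P i)⁻¹ = weylGroup.ofIdx P i :=
  inv_eq_of_mul_eq_one_left (ofIdx_mul_self i)

lemma ofIdx_mul_cancel (i : ι) (w : P.weylGroup) :
    weylGroup.ofIdx P i * (weylGroup.ofIdx P i * w) = w := by
  rw [← mul_assoc, ofIdx_mul_self, one_mul]

lemma length_le_of_prod (b : P.Base) (s : List P.weylGroup)
    (hs : ∀ x ∈ s, x ∈ simpleReflections b) : length b s.prod ≤ s.length :=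
  Nat.sInf_le ⟨s, hs, rfl, rfl⟩

lemma length_ofIdx_of_mem_support (b : P.Base) {i : ι} (hi : i ∈ b.support) :
    length b (weylGroup.ofIdx P i) ≤ 1 := by
  simpa using length_le_of_prod b [weylGroup.ofIdx P i] (by simpa using ⟨i, hi, rfl⟩)

variable [CharZero R]

lemma isPos_iff_not_of_root_eq_neg (b : P.Base) {i j : ι} (h : P.root j = -P.root i) :
    b.IsPos j ↔ ¬ b.IsPos i := by
  let := P.indexNeg
  have : j = -i := P.root.injective (by simp [h])
  rw [this]
  exact Base.IsPos.neg_iff_not b i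

lemma isPos_smul_ofIdx_smul_self (b : P.Base) (w : P.weylGroup) (i : ι) :
    b.IsPos (w • weylGroup.ofIdx P i • i) ↔ ¬ b.IsPos (w • i) := by
  apply isPos_iff_not_of_root_eq_neg
  rw [root_smul, ofIdx_smul_root, pairing_same, two_smul, sub_add_cancel_left, smul_neg,
    root_smul]

lemma isPos_inv_ofIdx_mul_smul_self (b : P.Base) (w : P.weylGroup) (i : ι) :
    b.IsPos ((weylGroup.ofIdx P i * w)⁻¹ • i) ↔ ¬ b.IsPos (w⁻¹ • i) := by
  rw [mul_inv_rev, ofIdx_inv, mul_smul, isPos_smul_ofIdx_smul_self]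

variable [Finite ι] [P.IsCrystallographic] [P.IsReduced]

lemma ofIdx_mem_closure (b : P.Base) (i : ι) :
    weylGroup.ofIdx P i ∈ Subgroup.closure (simpleReflections b) := by
  refine b.induction_reflect i (p := fun i => weylGroup.ofIdx P i ∈ _) ?_ ?_ ?_
  · intro i hi
    rw [← ofIdx_smul_index, ofIdx_smul_eq_conj]
    simpa using hi
  · intro i hi
    exact Subgroup.subset_closure ⟨i, hi, rfl⟩
  · intro i j hi hj
    rw [← ofIdx_smul_index, ofIdx_smul_eq_conj]
    have : weylGroup.ofIdx P j ∈ Subgroup.closure (simpleReflections b) :=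
      Subgroup.subset_closure ⟨j, hj, rfl⟩
    exact mul_mem (mul_mem this hi) (inv_mem this)

lemma closure_simpleReflections (b : P.Base) : Subgroup.closure (simpleReflections b) = ⊤ := by
  rw [eq_top_iff]
  rintro ⟨w, hw⟩ -
  induction hw using weylGroup.induction with
  | mem i => exact ofIdx_mem_closure b i
  | one => exact one_mem _
  | mul x y hx hy ihx ihy => exact mul_mem ihx ihy

lemma exists_prod_eq (b : P.Base) (w : P.weylGroup) :
    ∃ s : List P.weylGroup, (∀ x ∈ s, x ∈ simpleReflections b) ∧ s.prod = w := by
  have hw : w ∈ Subgroup.closure (simpleReflections b) := by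
    rw [closure_simpleReflections]; trivial
  induction hw using Subgroup.closure_induction_left with
  | one => exact ⟨[], by simp, rfl⟩
  | mul_left x hx y hy ih =>
    obtain ⟨s, hs, rfl⟩ := ih
    exact ⟨x :: s, List.forall_mem_cons.mpr ⟨hx, hs⟩, by simp⟩
  | inv_mul_cancel x hx y hy ih =>
    obtain ⟨s, hs, rfl⟩ := ih
    refine ⟨x :: s, List.forall_mem_cons.mpr ⟨hx, hs⟩, ?_⟩
    obtain ⟨i, -, rfl⟩ := hx
    simp [ofIdx_inv]

lemma exists_reduced_word (b : P.Base) (w : P.weylGroup) :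
    ∃ s : List P.weylGroup, (∀ x ∈ s, x ∈ simpleReflections b) ∧ s.prod = w ∧
      s.length = length b w := by
  obtain ⟨s, hs, h⟩ := exists_prod_eq b w
  exact Nat.sInf_mem (s := {l | ∃ s : List P.weylGroup, (∀ x ∈ s, x ∈ simpleReflections b) ∧
    s.prod = w ∧ s.length = l}) ⟨s.length, s, hs, h, rfl⟩

lemma length_mul_le (b : P.Base) (v w : P.weylGroup) :
    length b (v * w) ≤ length b v + length b w := by
  obtain ⟨s, hs, rfl, hs'⟩ := exists_reduced_word b v
  obtain ⟨t, ht, rfl, ht'⟩ := exists_reduced_word b w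
  rw [← hs', ← ht', ← List.prod_append, ← List.length_append]
  refine length_le_of_prod b _ fun x hx => ?_
  rcases List.mem_append.mp hx with h | h
  exacts [hs x h, ht x h]

/-- A simple reflection permutes the positive roots other than its own. Following the root through
the word, it can turn negative only at a letter equal to the reflection in its current image;
deleting that letter multiplies the word by s_i. -/
lemma exists_shorter_word (b : P.Base) (s : List P.weylGroup)
    (hs : ∀ x ∈ s, x ∈ simpleReflections b) {i : ι} (hi : b.IsPos i)
    (hn : ¬ b.IsPos (s.prod⁻¹ • i)) :
    ∃ t : List P.weylGroup, (∀ x ∈ t, x ∈ simpleReflections b) ∧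
      t.prod = weylGroup.ofIdx P i * s.prod ∧ t.length < s.length := by
  induction s generalizing i with
  | nil => simp [hi] at hn
  | cons x s ih =>
    have hx := hs x (by simp)
    obtain ⟨j, hj, rfl⟩ := id hx
    have hs' : ∀ x ∈ s, x ∈ simpleReflections b := fun y hy => hs y (by simp [hy])
    by_cases hij : i = j
    · subst hij
      exact ⟨s, hs', by simp [ofIdx_mul_cancel], by simp⟩
    · have hp := hi.reflectionPerm hj hij
      rw [← ofIdx_smul_index] at hp
      obtain ⟨t, ht, h1, h2⟩ := ih hs' hp (by
        simpa [mul_smul, ofIdx_inv] using hn)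
      refine ⟨weylGroup.ofIdx P j :: t, List.forall_mem_cons.mpr ⟨hx, ht⟩, ?_, by simpa using h2⟩
      rw [List.prod_cons, h1, ofIdx_smul_eq_conj, ofIdx_inv, List.prod_cons]
      simp only [mul_assoc, ofIdx_mul_cancel]

/-- The strong exchange property. -/
lemma length_ofIdx_mul_lt (b : P.Base) {i : ι} (hi : b.IsPos i) {w : P.weylGroup}
    (hw : ¬ b.IsPos (w⁻¹ • i)) : length b (weylGroup.ofIdx P i * w) < length b w := by
  obtain ⟨s, hs, rfl, hs'⟩ := exists_reduced_word b w
  obtain ⟨t, ht, h1, h2⟩ := exists_shorter_word b s hs hi hw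
  rw [← hs', ← h1]
  exact (length_le_of_prod b t ht).trans_lt h2

lemma lt_length_ofIdx_mul (b : P.Base) {i : ι} (hi : b.IsPos i) {w : P.weylGroup}
    (hw : b.IsPos (w⁻¹ • i)) : length b w < length b (weylGroup.ofIdx P i * w) := by
  have := length_ofIdx_mul_lt b hi (w := weylGroup.ofIdx P i * w)
    (by rw [isPos_inv_ofIdx_mul_smul_self]; simpa using hw)
  rwa [ofIdx_mul_cancel] at this

/-- Induction on height. A non-simple positive root pairs positively with some simple α_j, so s_j
lowers its height by at least 1, while s_i = s_j s_(s_j i) s_j adds at most 2 to the length. -/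
lemma length_ofIdx_le (b : P.Base) {i : ι} (hi : b.IsPos i) :
    (length b (weylGroup.ofIdx P i) : ℤ) ≤ 2 * b.height i - 1 := by
  generalize hn : (b.height i).toNat = n
  induction n using Nat.strongRecOn generalizing i with
  | ind n ih =>
    have hi' := hi
    rw [Base.isPos_iff] at hi'
    obtain ⟨j, hj, hij⟩ := hi.exists_mem_support_pos_pairingIn
    rw [P.zero_lt_pairingIn_iff'] at hij
    have hlj := length_ofIdx_of_mem_support b hj
    rcases eq_or_ne i j with rfl | hne
    · rw [Base.height_one_of_mem_support hj]
      omega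
    · have hk := hi.reflectionPerm hj hne
      have hk' := hk
      rw [Base.isPos_iff] at hk'
      have hr := P.reflection_apply_root' ℤ (i := j) (j := i)
      rw [← root_reflectionPerm, sub_eq_add_neg, ← neg_smul] at hr
      have hht := b.height_add_zsmul hr
      rw [Base.height_one_of_mem_support hj] at hht
      simp only [smul_eq_mul, mul_one] at hht
      have h := ih _ (by omega) hk rfl
      rw [← ofIdx_smul_index] at h hk' hht
      have e : weylGroup.ofIdx P i = weylGroup.ofIdx P j *
          (weylGroup.ofIdx P (weylGroup.ofIdx P j • i) * weylGroup.ofIdx P j) := by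
        rw [ofIdx_smul_eq_conj, ofIdx_inv]
        simp [mul_assoc, ofIdx_mul_cancel, ofIdx_mul_self]
      have h1 := length_mul_le b (weylGroup.ofIdx P j)
          (weylGroup.ofIdx P (weylGroup.ofIdx P j • i) * weylGroup.ofIdx P j)
      have h2 := length_mul_le b (weylGroup.ofIdx P (weylGroup.ofIdx P j • i))
        (weylGroup.ofIdx P j)
      rw [← e] at h1
      omega

end RootSystem

/-! ### Weighted translations on a free module. -/

section WeightedTranslation

variable {G K : Type*} [CommRing K]

lemma end_ext_single {f g : Module.End K (G →₀ K)}
    (h : ∀ w, f (Finsupp.single w 1) = g (Finsupp.single w 1)) : f = g := by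
  refine Finsupp.lhom_ext fun w a => ?_
  have : Finsupp.single w a = a • Finsupp.single w (1 : K) := by simp
  rw [this, map_smul, map_smul, h]

variable [Mul G]

/-- The operator `w ↦ c(w) gw`. -/
def weightedTranslation (g : G) (c : G → K) : Module.End K (G →₀ K) :=
  Finsupp.linearCombination K fun w => Finsupp.single (g * w) (c w)

@[simp] lemma weightedTranslation_single (g : G) (c : G → K) (w : G) (a : K) :
    weightedTranslation g c (Finsupp.single w a) = Finsupp.single (g * w) (a * c w) := by
  simp [weightedTranslation]

end WeightedTranslation

/-- Both sides at `x v` reduce, by the common quadratic relation, to p f(y v) + q y v. In the braid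
relation `y` is the alternating product shared by the two sides. -/
lemma apply_eq_of_quadratic {K V : Type*} [CommRing K] [AddCommGroup V] [Module K V]
    {x f y : Module.End K V} {p q : K} {v : V}
    (hx : x * x = p • x + q • 1) (hf : f * f = p • f + q • 1)
    (h : (y * x) v = (f * y) v) : (y * x) (x v) = (f * y) (x v) := by
  have h1 : (f * y) (x v) = (f * f) (y v) := by
    change f ((y * x) v) = f ((f * y) v)
    rw [h]
  have h2 : (y * x) (x v) = y ((x * x) v) := rfl
  have h3 : y (x v) = f (y v) := h
  rw [h1, h2, hx, hf]
  simp [h3]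

/-! ### Hecke and mixed Bruhat operators, and telescoping along words. -/

section Operators

variable {ι R M N : Type*} [Field R] [AddCommGroup M] [Module R M]
  [AddCommGroup N] [Module R N] {P : RootPairing ι R M N}
  {K : Type*} [CommRing K]

variable (P K) in
/-- Left translation on the free module on the Weyl group. -/
def translation (g : P.weylGroup) : Module.End K (P.weylGroup →₀ K) :=
  weightedTranslation g 1

@[simp] lemma translation_single (g w : P.weylGroup) (a : K) :
    translation P K g (Finsupp.single w a) = Finsupp.single (g * w) a := by
  simp [translation]

lemma translation_mul (g h : P.weylGroup) :
    translation P K (g * h) = translation P K g * translation P K h :=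
  end_ext_single fun w => by simp [mul_assoc]

lemma translation_one : translation P K 1 = 1 :=
  end_ext_single fun w => by simp

variable [CharZero R] (b : P.Base)

open Classical in
/-- The operator `w ↦ c s_i w + d [w⁻¹ α_i > 0] w`. -/
def heckeOp (c d : K) (i : ι) : Module.End K (P.weylGroup →₀ K) :=
  c • translation P K (weylGroup.ofIdx P i) +
    weightedTranslation 1 fun w => if b.IsPos (w⁻¹ • i) then d else 0

open Classical in
/-- The operator `w ↦ c (1 - e) w + d s_i w` if `w⁻¹ α_i > 0`, and
`w ↦ c (1 - e) w + d e s_i w` otherwise. -/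
def mixedBruhatOp (c d : K) (i : ι) (e : K) : Module.End K (P.weylGroup →₀ K) :=
  (c * (1 - e)) • 1 +
    weightedTranslation (weylGroup.ofIdx P i) fun w => if b.IsPos (w⁻¹ • i) then d else d * e

variable (c d : K)

/-- The spectral factor `(1 - e) H_i + d e`. -/
def spectralFactor (i : ι) (e : K) : Module.End K (P.weylGroup →₀ K) :=
  (1 - e) • heckeOp b c d i + (d * e) • 1

lemma heckeOp_single_of_isPos {i : ι} {w : P.weylGroup} (h : b.IsPos (w⁻¹ • i)) :
    heckeOp b c d i (Finsupp.single w 1) =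
      c • Finsupp.single (weylGroup.ofIdx P i * w) 1 + d • Finsupp.single w 1 := by
  simp [heckeOp, h]

lemma heckeOp_single_of_not_isPos {i : ι} {w : P.weylGroup} (h : ¬ b.IsPos (w⁻¹ • i)) :
    heckeOp b c d i (Finsupp.single w 1) =
      c • Finsupp.single (weylGroup.ofIdx P i * w) 1 := by
  simp [heckeOp, h]

lemma heckeOp_mul_self (i : ι) :
    heckeOp b c d i * heckeOp b c d i = d • heckeOp b c d i + (c * c) • 1 := by
  refine end_ext_single fun w => ?_
  have hw := isPos_inv_ofIdx_mul_smul_self b w i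
  by_cases h : b.IsPos (w⁻¹ • i)
  · rw [Module.End.mul_apply, heckeOp_single_of_isPos b c d h, map_add, map_smul, map_smul,
      heckeOp_single_of_not_isPos b c d (by rw [hw]; simpa using h), LinearMap.add_apply,
      LinearMap.smul_apply, heckeOp_single_of_isPos b c d h, ofIdx_mul_cancel,
      LinearMap.smul_apply, Module.End.one_apply]
    module
  · rw [Module.End.mul_apply, heckeOp_single_of_not_isPos b c d h, map_smul,
      heckeOp_single_of_isPos b c d (by rw [hw]; simpa using h), LinearMap.add_apply,
      LinearMap.smul_apply, heckeOp_single_of_not_isPos b c d h, ofIdx_mul_cancel,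
      LinearMap.smul_apply, Module.End.one_apply]
    module

lemma mixedBruhatOp_eq (i : ι) (e : K) :
    mixedBruhatOp b c d i e =
      translation P K (weylGroup.ofIdx P i) * spectralFactor b c d i e := by
  refine end_ext_single fun w => ?_
  by_cases h : b.IsPos (w⁻¹ • i) <;>
  simp only [mixedBruhatOp, spectralFactor, heckeOp, h, LinearMap.add_apply, LinearMap.smul_apply,
    Module.End.one_apply, Module.End.mul_apply, weightedTranslation_single, translation_single,
    map_add, ofIdx_mul_cancel, one_mul, if_true, if_false, Finsupp.smul_single,
    smul_eq_mul, mul_one, mul_zero, Finsupp.single_zero, smul_zero, zero_add, ← Finsupp.single_add, add_assoc,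
    smul_add]
  · congr 2
    · ring
    · ring
  · congr 2
    ring

open Classical in
lemma mixedBruhatOp_single (i : ι) (e : K) (w : P.weylGroup) :
    mixedBruhatOp b c d i e (Finsupp.single w 1) = (c * (1 - e)) • Finsupp.single w 1 +
      (if b.IsPos (w⁻¹ • i) then d else d * e) • Finsupp.single (weylGroup.ofIdx P i * w) 1 := by
  simp only [mixedBruhatOp, LinearMap.add_apply, LinearMap.smul_apply, Module.End.one_apply,
    weightedTranslation_single, one_mul, Finsupp.smul_single, smul_eq_mul, mul_one]

/-- The sign deciding the coefficient is that of w⁻¹ α_i, which is unchanged when u acts on both w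
and α_i. -/
lemma mixedBruhatOp_smul (u : P.weylGroup) (i : ι) (e : K) :
    mixedBruhatOp b c d (u • i) e * translation P K u =
      translation P K u * mixedBruhatOp b c d i e := by
  refine end_ext_single fun w => ?_
  have h : (u * w)⁻¹ • u • i = w⁻¹ • i := by rw [smul_smul]; congr 1; group
  rw [Module.End.mul_apply, Module.End.mul_apply, translation_single, mixedBruhatOp_single,
    mixedBruhatOp_single, map_add, map_smul, map_smul, translation_single, translation_single,
    ofIdx_smul_eq_conj, h]
  simp only [mul_assoc, inv_mul_cancel_left]

section Words

variable (s : ℕ → ι)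

variable (P) in
/-- The element `s_0 s_1 ⋯ s_{n-1}` of the Weyl group. -/
def wordProd : ℕ → P.weylGroup
  | 0 => 1
  | n + 1 => wordProd n * weylGroup.ofIdx P (s n)

variable (e : ℕ → K)

/-- The product of the operators attached to the roots `s_0 ⋯ s_{n-1} α_n`, in decreasing order. -/
def mixedBruhatProd : ℕ → Module.End K (P.weylGroup →₀ K)
  | 0 => 1
  | n + 1 => mixedBruhatOp b c d (wordProd P s n • s n) (e n) * mixedBruhatProd n

/-- The product of the spectral factors along a word, in decreasing order. -/
def spectralProd : ℕ → Module.End K (P.weylGroup →₀ K)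
  | 0 => 1
  | n + 1 => spectralFactor b c d (s n) (e n) * spectralProd n

/-- The product of the Hecke operators along a word, in decreasing order. -/
def heckeProd : ℕ → Module.End K (P.weylGroup →₀ K)
  | 0 => 1
  | n + 1 => heckeOp b c d (s n) * heckeProd n

/-- Each new operator is moved past the accumulated translation by equivariance, becoming the
operator of the letter `s n`, and then splits off its own reflection. -/
lemma mixedBruhatProd_eq (n : ℕ) :
    mixedBruhatProd b c d s e n = translation P K (wordProd P s n) * spectralProd b c d s e n := by
  induction n with
  | zero => simp [mixedBruhatProd, wordProd, spectralProd, translation_one]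
  | succ n ih =>
    rw [mixedBruhatProd, ih, ← mul_assoc, mixedBruhatOp_smul, mixedBruhatOp_eq, wordProd,
      spectralProd, translation_mul]
    simp only [mul_assoc]

/-- The hypothesis keeps every factor in its one-term branch, so no diagonal terms appear. -/
lemma heckeProd_single {w : P.weylGroup} (n : ℕ)
    (h : ∀ k < n, ¬ b.IsPos (w⁻¹ • wordProd P s k • s k)) :
    heckeProd b c d s n (Finsupp.single w 1) =
      c ^ n • Finsupp.single ((wordProd P s n)⁻¹ * w) 1 := by
  induction n with
  | zero => simp [heckeProd, wordProd]
  | succ n ih =>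
    rw [heckeProd, Module.End.mul_apply, ih fun k hk => h k (by omega), map_smul,
      heckeOp_single_of_not_isPos]
    · rw [smul_smul, ← pow_succ, wordProd, mul_inv_rev, ofIdx_inv, mul_assoc]
    · simpa [mul_smul] using h n (by omega)

end Words

end Operators

/-! ### Finiteness of the Weyl group. -/

section Finiteness

variable {ι R M N : Type*} [CommRing R] [AddCommGroup M] [Module R M]
  [AddCommGroup N] [Module R N] {P : RootPairing ι R M N} [P.IsRootSystem]

lemma weylGroup_ext {v w : P.weylGroup} (h : ∀ i : ι, v • i = w • i) : v = w := by
  apply Subtype.ext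
  apply Equiv.weightHom_injective P
  apply LinearEquiv.toLinearMap_injective
  refine LinearMap.ext_on_range (IsRootSystem.span_root_eq_top (P := P)) fun i => ?_
  have h1 := weylGroup_apply_root P v i
  have h2 := weylGroup_apply_root P w i
  exact h1.trans ((congrArg P.root (h i)).trans h2.symm)

lemma finite_weylGroup [Finite ι] : Finite P.weylGroup :=
  Finite.of_injective (fun (w : P.weylGroup) (i : ι) => w • i) fun _ _ h =>
    weylGroup_ext (congrFun h)

end Finiteness

/-! ### Alternating words and their roots. -/

section Alternate

variable {ι : Type*}

/-- The alternating sequence `i, j, i, j, …`. -/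
def alternate (i j : ι) : ℕ → ι
  | 0 => i
  | n + 1 => alternate j i n

variable {R M N : Type*} [Field R] [AddCommGroup M] [Module R M]
  [AddCommGroup N] [Module R N] {P : RootPairing ι R M N}

lemma wordProd_succ_left (s : ℕ → ι) (n : ℕ) :
    wordProd P s (n + 1) = weylGroup.ofIdx P (s 0) * wordProd P (fun k => s (k + 1)) n := by
  induction n with
  | zero => simp [wordProd]
  | succ n ih => rw [wordProd, ih, mul_assoc, wordProd]

variable (P) in
/-- The index of the root `s_i s_j s_i ⋯` (`n` factors) applied to `α_i` or `α_j`. -/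
def alternatingRoot (i j : ι) (n : ℕ) : ι :=
  wordProd P (alternate i j) n • alternate i j n

lemma alternatingRoot_succ (i j : ι) (n : ℕ) :
    alternatingRoot P i j (n + 1) = weylGroup.ofIdx P i • alternatingRoot P j i n := by
  rw [alternatingRoot, wordProd_succ_left, mul_smul]
  rfl

lemma mul_pow_mul_comm {G : Type*} [Monoid G] (x y : G) (n : ℕ) :
    x * (y * x) ^ n = (x * y) ^ n * x := by
  induction n with
  | zero => simp
  | succ n ih => rw [pow_succ, ← mul_assoc, ih, pow_succ]; simp only [mul_assoc]

lemma ofIdx_alternatingRoot (i j : ι) (n : ℕ) :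
    weylGroup.ofIdx P (alternatingRoot P i j n) =
      (weylGroup.ofIdx P i * weylGroup.ofIdx P j) ^ n * weylGroup.ofIdx P i := by
  induction n generalizing i j with
  | zero => simp [alternatingRoot, wordProd, alternate]
  | succ n ih =>
    rw [alternatingRoot_succ, ofIdx_smul_eq_conj, ih, ofIdx_inv, ← mul_assoc, mul_pow_mul_comm,
      pow_succ, mul_assoc _ (weylGroup.ofIdx P i) (weylGroup.ofIdx P j)]

/-- If the last root is α_j, then s_j is the conjugate of the last letter by the preceding prefix,
so appending that letter on the right amounts to prepending s_j on the left. -/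
lemma wordProd_alternate_eq {i j : ι} {n : ℕ} (h : alternatingRoot P i j n = j) :
    wordProd P (alternate i j) (n + 1) = wordProd P (alternate j i) (n + 1) := by
  have h1 : weylGroup.ofIdx P j * wordProd P (alternate i j) n =
      wordProd P (alternate i j) (n + 1) := by
    have h2 : weylGroup.ofIdx P j = weylGroup.ofIdx P (alternatingRoot P i j n) := by rw [h]
    rw [h2, alternatingRoot, ofIdx_smul_eq_conj, wordProd, inv_mul_cancel_right]
  rw [← h1, wordProd_succ_left]
  rfl

lemma pow_succ_eq_one_of_alternatingRoot {i j : ι} {n : ℕ} (h : alternatingRoot P i j n = j) :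
    (weylGroup.ofIdx P i * weylGroup.ofIdx P j) ^ (n + 1) = 1 := by
  have h1 := ofIdx_alternatingRoot (P := P) i j n
  rw [h] at h1
  rw [pow_succ, ← mul_assoc, ← h1, ofIdx_mul_self]

end Alternate

/-! ### The braid relation for Hecke operators. -/

section Braid

variable {ι R M N : Type*} [Field R] [CharZero R] [AddCommGroup M] [Module R M]
  [AddCommGroup N] [Module R N] {P : RootPairing ι R M N} (b : P.Base)
  {K : Type*} [CommRing K] (c d : K)

lemma heckeProd_succ_right (s : ℕ → ι) (n : ℕ) :
    heckeProd b c d s (n + 1) = heckeProd b c d (fun k => s (k + 1)) n * heckeOp b c d (s 0) := by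
  induction n with
  | zero => simp [heckeProd]
  | succ n ih => rw [heckeProd, ih, ← mul_assoc, heckeProd]

lemma heckeProd_alternate_apply {i j : ι} {n : ℕ} {v : P.weylGroup →₀ K}
    (h : heckeProd b c d (alternate i j) (n + 1) v = heckeProd b c d (alternate j i) (n + 1) v) :
    heckeProd b c d (alternate i j) (n + 1) (heckeOp b c d i v) =
      heckeProd b c d (alternate j i) (n + 1) (heckeOp b c d i v) := by
  rw [heckeProd_succ_right] at h ⊢
  exact apply_eq_of_quadratic (heckeOp_mul_self b c d i) (heckeOp_mul_self b c d _) h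

variable [IsDomain K]

lemma single_eq_of_heckeOp {c : K} (hc : c ≠ 0) {f g : Module.End K (P.weylGroup →₀ K)} {i : ι}
    {w : P.weylGroup} (hw : b.IsPos (w⁻¹ • i))
    (h : f (heckeOp b c d i (Finsupp.single (weylGroup.ofIdx P i * w) 1)) =
      g (heckeOp b c d i (Finsupp.single (weylGroup.ofIdx P i * w) 1))) :
    f (Finsupp.single w 1) = g (Finsupp.single w 1) := by
  rw [heckeOp_single_of_not_isPos _ _ _ (by rw [isPos_inv_ofIdx_mul_smul_self]; simpa using hw),
    ofIdx_mul_cancel, map_smul, map_smul] at h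
  exact smul_right_injective _ hc h

variable [P.IsRootSystem] [Finite ι] [P.IsCrystallographic] [P.IsReduced]

/-- If w⁻¹ α_i > 0, then w is up to the factor `c` the image under H_i of the longer element s_i w,
and agreement of the two sides at a vector passes to its image under H_i. The same holds for j. If
both roots are made negative, both sides are a single group element with the same coefficient. -/
lemma heckeProd_braid {c : K} (hc : c ≠ 0) {i j : ι} (hi : b.IsPos i) (hj : b.IsPos j) {n : ℕ}
    (hij : ∀ w : P.weylGroup, ¬ b.IsPos (w⁻¹ • i) → ¬ b.IsPos (w⁻¹ • j) → ∀ k ≤ n,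
      ¬ b.IsPos (w⁻¹ • alternatingRoot P i j k) ∧ ¬ b.IsPos (w⁻¹ • alternatingRoot P j i k))
    (hn : alternatingRoot P i j n = j) :
    heckeProd b c d (alternate i j) (n + 1) = heckeProd b c d (alternate j i) (n + 1) := by
  refine end_ext_single fun w => ?_
  have := finite_weylGroup (P := P)
  obtain ⟨L, hL⟩ := (Set.finite_range (length b)).bddAbove
  replace hL (w : P.weylGroup) : length b w ≤ L := hL ⟨w, rfl⟩
  generalize hl : L - length b w = l
  -- The induction is on L - ℓ(w), where L bounds all lengths: longer elements come first.
  induction l using Nat.strongRecOn generalizing w with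
  | ind l ih =>
    by_cases h1 : b.IsPos (w⁻¹ • i)
    · have := lt_length_ofIdx_mul b hi h1
      have := hL (weylGroup.ofIdx P i * w)
      exact single_eq_of_heckeOp b d hc h1 (heckeProd_alternate_apply b c d
        (ih (L - length b (weylGroup.ofIdx P i * w)) (by omega) _ rfl))
    by_cases h2 : b.IsPos (w⁻¹ • j)
    · have := lt_length_ofIdx_mul b hj h2
      have := hL (weylGroup.ofIdx P j * w)
      exact single_eq_of_heckeOp b d hc h2 (heckeProd_alternate_apply b c d
        (ih (L - length b (weylGroup.ofIdx P j * w)) (by omega) _ rfl).symm).symm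
    rw [heckeProd_single, heckeProd_single, wordProd_alternate_eq hn]
    · exact fun k hk => (hij w h1 h2 k (by omega)).2
    · exact fun k hk => (hij w h1 h2 k (by omega)).1

end Braid

/-! ### Yang–Baxter identities with spectral parameters in rank two. -/

section HeckeIdentities

variable {K A : Type*} [CommRing K] [Ring A] [Algebra K A] {p q : K} {a b : A}

/-- The quadratic and braid relations reduce both expansions to common words in `a` and `b`; the
coefficients then agree as polynomials. The parameter of the root α + β is the product `x * y`. The
identities for four and six factors are proved in the same way. -/
lemma spectral_three (ha : a * a = p • a + q • 1) (hb : b * b = p • b + q • 1)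
    (hab : a * (b * a) = b * (a * b)) (x y : K) :
    ((1 - y) • a + (p * y) • 1) * (((1 - x * y) • b + (p * (x * y)) • 1) *
      ((1 - x) • a + (p * x) • 1)) =
    ((1 - x) • b + (p * x) • 1) * (((1 - x * y) • a + (p * (x * y)) • 1) *
      ((1 - y) • b + (p * y) • 1)) := by
  simp only [mul_add, add_mul, smul_mul_assoc, mul_smul_comm, one_mul, mul_one, ha, hb, hab,
    smul_add, smul_smul]
  match_scalars <;> ring

lemma spectral_four (ha : a * a = p • a + q • 1) (hb : b * b = p • b + q • 1)
    (hab : b * (a * (b * a)) = a * (b * (a * b))) (x y : K) :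
    ((1 - y) • b + (p * y) • 1) * (((1 - x * y) • a + (p * (x * y)) • 1) *
      (((1 - x ^ 2 * y) • b + (p * (x ^ 2 * y)) • 1) * ((1 - x) • a + (p * x) • 1))) =
    ((1 - x) • a + (p * x) • 1) * (((1 - x ^ 2 * y) • b + (p * (x ^ 2 * y)) • 1) *
      (((1 - x * y) • a + (p * (x * y)) • 1) * ((1 - y) • b + (p * y) • 1))) := by
  -- In right-nested words a square occurs in front of a tail, where `ha` and `hb` do not match.
  have ha' (z : A) : a * (a * z) = p • (a * z) + q • z := by
    rw [← mul_assoc, ha, add_mul, smul_mul_assoc, smul_mul_assoc, one_mul]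
  have hb' (z : A) : b * (b * z) = p • (b * z) + q • z := by
    rw [← mul_assoc, hb, add_mul, smul_mul_assoc, smul_mul_assoc, one_mul]
  simp only [mul_add, add_mul, smul_mul_assoc, mul_smul_comm, one_mul, mul_one, ha, hb, hab,
    ha', hb', smul_add, smul_smul]
  match_scalars <;> ring

set_option maxHeartbeats 1000000 in
lemma spectral_six (ha : a * a = p • a + q • 1) (hb : b * b = p • b + q • 1)
    (hab : b * (a * (b * (a * (b * a)))) = a * (b * (a * (b * (a * b))))) (x y : K) :
    ((1 - y) • b + (p * y) • 1) * (((1 - x * y) • a + (p * (x * y)) • 1) *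
      (((1 - x ^ 3 * y ^ 2) • b + (p * (x ^ 3 * y ^ 2)) • 1) *
      (((1 - x ^ 2 * y) • a + (p * (x ^ 2 * y)) • 1) *
      (((1 - x ^ 3 * y) • b + (p * (x ^ 3 * y)) • 1) * ((1 - x) • a + (p * x) • 1))))) =
    ((1 - x) • a + (p * x) • 1) * (((1 - x ^ 3 * y) • b + (p * (x ^ 3 * y)) • 1) *
      (((1 - x ^ 2 * y) • a + (p * (x ^ 2 * y)) • 1) *
      (((1 - x ^ 3 * y ^ 2) • b + (p * (x ^ 3 * y ^ 2)) • 1) *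
      (((1 - x * y) • a + (p * (x * y)) • 1) * ((1 - y) • b + (p * y) • 1))))) := by
  have ha' (z : A) : a * (a * z) = p • (a * z) + q • z := by
    rw [← mul_assoc, ha, add_mul, smul_mul_assoc, smul_mul_assoc, one_mul]
  have hb' (z : A) : b * (b * z) = p • (b * z) + q • z := by
    rw [← mul_assoc, hb, add_mul, smul_mul_assoc, smul_mul_assoc, one_mul]
  simp only [mul_add, add_mul, smul_mul_assoc, mul_smul_comm, one_mul, mul_one, ha, hb, hab,
    ha', hb', smul_add, smul_smul]
  match_scalars <;> ring

end HeckeIdentities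

/-! ### Coordinates of the positive roots of a rank two system. -/

section Coefficients

/-- The coefficients of the roots `s_i s_j s_i ⋯` (`n` factors) applied to `α_i` or `α_j`, when
the pairings of `α_j` with `α_i` and of `α_i` with `α_j` are `z` and `z'`. -/
def alternatingCoeff (z z' : ℤ) : ℕ → ℤ × ℤ
  | 0 => (1, 0)
  | n + 1 => (-(alternatingCoeff z' z n).2 - (alternatingCoeff z' z n).1 * z,
      (alternatingCoeff z' z n).1)

/-- A rank two root system with pairings `z` and `z'` has `n + 1` positive roots. -/
def IsDihedralType (z z' : ℤ) (n : ℕ) : Prop :=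
  (∀ k ≤ n, 0 ≤ (alternatingCoeff z z' k).1 ∧ 0 ≤ (alternatingCoeff z z' k).2 ∧
    (k ≠ 0 → (alternatingCoeff z z' k).2 ≠ 0)) ∧
  ∀ k ≤ n, alternatingCoeff z' z k = (alternatingCoeff z z' (n - k)).swap

variable {ι R M N : Type*} [Field R] [AddCommGroup M] [Module R M]
  [AddCommGroup N] [Module R N] {P : RootPairing ι R M N}

lemma root_alternatingRoot {i j : ι} {z z' : ℤ} (h : P.pairing j i = z) (h' : P.pairing i j = z')
    (n : ℕ) : P.root (alternatingRoot P i j n) =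
      (alternatingCoeff z z' n).1 • P.root i + (alternatingCoeff z z' n).2 • P.root j := by
  induction n generalizing i j z z' with
  | zero => simp [alternatingRoot, wordProd, alternate, alternatingCoeff]
  | succ n ih =>
    have hs (k : ι) : weylGroup.ofIdx P i • P.root k = P.root k - P.pairing k i • P.root i := by
      rw [← root_smul, ofIdx_smul_root]
    have hz (m : ℤ) (v : M) : weylGroup.ofIdx P i • (m • v) = m • (weylGroup.ofIdx P i • v) :=
      map_zsmul (DistribSMul.toAddMonoidHom M (weylGroup.ofIdx P i)) m v
    rw [alternatingRoot_succ, root_smul, ih h' h, smul_add, hz, hz, hs, hs, h, pairing_same,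
      alternatingCoeff]
    module

lemma IsDihedralType.alternatingRoot_swap {z z' : ℤ} {n : ℕ} (hn : IsDihedralType z z' n)
    {i j : ι} (h : P.pairing j i = z) (h' : P.pairing i j = z') {k : ℕ} (hk : k ≤ n) :
    alternatingRoot P j i k = alternatingRoot P i j (n - k) := by
  apply P.root.injective
  rw [root_alternatingRoot h' h, root_alternatingRoot h h', hn.2 k hk, add_comm]
  rfl

lemma IsDihedralType.alternatingRoot_last {z z' : ℤ} {n : ℕ} (hn : IsDihedralType z z' n)
    {i j : ι} (h : P.pairing j i = z) (h' : P.pairing i j = z') :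
    alternatingRoot P i j n = j := by
  rw [← Nat.sub_zero n, ← hn.alternatingRoot_swap h h' (Nat.zero_le n)]
  simp [alternatingRoot, wordProd, alternate]

variable [CharZero R] (b : P.Base)

lemma height_eq_of_root_eq {i j k : ι} {p q : ℤ} (h : P.root k = p • P.root i + q • P.root j) :
    b.height k = p * b.height i + q * b.height j := by
  obtain ⟨f, -, -, hf⟩ := b.exists_root_eq_sum_int i
  obtain ⟨g, -, -, hg⟩ := b.exists_root_eq_sum_int j
  have hfg : P.root k = ∑ l ∈ b.support, (p • f + q • g) l • P.root l := by
    simp_rw [Pi.add_apply, Pi.smul_apply, add_smul, smul_assoc, Finset.sum_add_distrib,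
      ← Finset.smul_sum, ← hf, ← hg, h]
  simp_rw [Base.height_eq_sum hf, Base.height_eq_sum hg, Base.height_eq_sum hfg, Pi.add_apply,
    Pi.smul_apply, Finset.sum_add_distrib, Finset.mul_sum, smul_eq_mul]

lemma height_smul_of_root_eq {i j k : ι} {p q : ℤ} (h : P.root k = p • P.root i + q • P.root j)
    (w : P.weylGroup) : b.height (w • k) = p * b.height (w • i) + q * b.height (w • j) := by
  have hz (m : ℤ) (v : M) : w • (m • v) = m • (w • v) :=
    map_zsmul (DistribSMul.toAddMonoidHom M w) m v
  apply height_eq_of_root_eq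
  rw [root_smul, h, smul_add, hz, hz, root_smul, root_smul]

lemma isPos_of_root_eq {i j k : ι} {p q : ℤ} (h : P.root k = p • P.root i + q • P.root j)
    (hp : 0 ≤ p) (hq : 0 ≤ q) (hi : b.IsPos i) (hj : b.IsPos j) : b.IsPos k := by
  rw [Base.isPos_iff] at hi hj
  rw [Base.isPos_iff', height_eq_of_root_eq b h]
  positivity

lemma not_isPos_smul_of_root_eq {i j k : ι} {p q : ℤ}
    (h : P.root k = p • P.root i + q • P.root j) (hp : 0 ≤ p) (hq : 0 ≤ q) (w : P.weylGroup)
    (hi : ¬ b.IsPos (w • i)) (hj : ¬ b.IsPos (w • j)) : ¬ b.IsPos (w • k) := by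
  rw [Base.isPos_iff, not_lt] at *
  rw [height_smul_of_root_eq b h]
  nlinarith

lemma IsDihedralType.isPos_alternatingRoot {z z' : ℤ} {n : ℕ} (hn : IsDihedralType z z' n)
    {i j : ι} (h : P.pairing j i = z) (h' : P.pairing i j = z') (hi : b.IsPos i) (hj : b.IsPos j)
    {k : ℕ} (hk : k ≤ n) : b.IsPos (alternatingRoot P i j k) :=
  isPos_of_root_eq b (root_alternatingRoot h h' k) (hn.1 k hk).1 (hn.1 k hk).2.1 hi hj

variable [P.IsReduced]

lemma linearIndependent_of_isPos {i j : ι} (hi : b.IsPos i) (hj : b.IsPos j) (hij : i ≠ j) :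
    LinearIndependent R ![P.root i, P.root j] :=
  IsReduced.linearIndependent P hij fun h => (isPos_iff_not_of_root_eq_neg b h).mp hi hj

lemma ofIdx_injOn_isPos {i j : ι} (hi : b.IsPos i) (hj : b.IsPos j)
    (h : weylGroup.ofIdx P i = weylGroup.ofIdx P j) : i = j := by
  by_contra hij
  have hl := linearIndependent_of_isPos b hi hj hij
  have h1 := ofIdx_smul_root (P := P) i i
  rw [h, ofIdx_smul_root, pairing_same] at h1
  have := LinearIndependent.pair_iff.mp hl 2 (-P.pairing i j) (by
    rw [neg_smul, ← sub_eq_add_neg, ← sub_eq_zero.mpr h1]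
    module)
  exact two_ne_zero this.1

variable {b}

/-- If (s_i s_j)^k = 1 with 0 < k ≤ n, then the k-th alternating root has the same reflection as α_i
and is positive, so it equals α_i; but its coefficient at α_j is nonzero. -/
lemma IsDihedralType.orderOf_eq {z z' : ℤ} {n : ℕ} (hn : IsDihedralType z z' n)
    {i j : ι} (h : P.pairing j i = z) (h' : P.pairing i j = z') (hi : b.IsPos i) (hj : b.IsPos j)
    (hij : i ≠ j) : orderOf (weylGroup.ofIdx P i * weylGroup.ofIdx P j) = n + 1 := by
  rw [orderOf_eq_iff n.succ_pos]
  refine ⟨pow_succ_eq_one_of_alternatingRoot (hn.alternatingRoot_last h h'), fun k hk hk0 hp => ?_⟩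
  have h1 := ofIdx_alternatingRoot (P := P) i j k
  rw [hp, one_mul] at h1
  have h2 := ofIdx_injOn_isPos b (hn.isPos_alternatingRoot b h h' hi hj (by omega)) hi h1
  have h3 := root_alternatingRoot h h' k
  rw [h2] at h3
  have h4 := LinearIndependent.pair_iff.mp (linearIndependent_of_isPos b hi hj hij)
    ((alternatingCoeff z z' k).1 - 1 : ℤ) ((alternatingCoeff z z' k).2 : ℤ) (by
      rw [← sub_eq_zero.mpr h3.symm]
      module)
  exact (hn.1 k (by omega)).2.2 hk0.ne' (by exact_mod_cast h4.2)

variable {K : Type*} [CommRing K] [IsDomain K] [P.IsRootSystem] [Finite ι] [P.IsCrystallographic]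

lemma IsDihedralType.heckeProd_eq {z z' : ℤ} {n : ℕ} (hn : IsDihedralType z z' n)
    {i j : ι} (h : P.pairing j i = z) (h' : P.pairing i j = z') (hi : b.IsPos i) (hj : b.IsPos j)
    {c : K} (hc : c ≠ 0) (d : K) :
    heckeProd b c d (alternate i j) (n + 1) = heckeProd b c d (alternate j i) (n + 1) := by
  have key (w : P.weylGroup) (h1 : ¬ b.IsPos (w⁻¹ • i)) (h2 : ¬ b.IsPos (w⁻¹ • j)) (k : ℕ)
      (hk : k ≤ n) : ¬ b.IsPos (w⁻¹ • alternatingRoot P i j k) :=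
    not_isPos_smul_of_root_eq b (root_alternatingRoot h h' k) (hn.1 k hk).1 (hn.1 k hk).2.1 _ h1 h2
  refine heckeProd_braid b d hc hi hj (fun w h1 h2 k hk => ⟨key w h1 h2 k hk, ?_⟩)
    (hn.alternatingRoot_last h h')
  rw [hn.alternatingRoot_swap h h' hk]
  exact key w h1 h2 _ (by omega)

end Coefficients

/-! ### The four rank two types with multiplicative weights. -/

section RankTwo

variable {ι R M N : Type*} [Field R] [CharZero R] [AddCommGroup M] [Module R M]
  [AddCommGroup N] [Module R N] {P : RootPairing ι R M N} {b : P.Base}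
  {K : Type*} [CommRing K]

/-- A function on all roots which is multiplicative on the positive ones. -/
def IsMultiplicativeOn (b : P.Base) (F : ι → K) : Prop :=
  ∀ i j k, b.IsPos i → b.IsPos j → b.IsPos k → P.root k = P.root i + P.root j → F k = F i * F j

lemma isDihedralType_one : IsDihedralType 0 0 1 := by unfold IsDihedralType; decide

lemma isDihedralType_two : IsDihedralType (-1) (-1) 2 := by unfold IsDihedralType; decide

lemma isDihedralType_three : IsDihedralType (-2) (-1) 3 := by unfold IsDihedralType; decide

lemma isDihedralType_five : IsDihedralType (-3) (-1) 5 := by unfold IsDihedralType; decide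

lemma isDihedralType_three' : IsDihedralType (-1) (-2) 3 := by unfold IsDihedralType; decide

lemma isDihedralType_five' : IsDihedralType (-1) (-3) 5 := by unfold IsDihedralType; decide

variable [P.IsReduced] [IsDomain K] [P.IsRootSystem] [Finite ι] [P.IsCrystallographic]
  {F : ι → K} (hF : IsMultiplicativeOn b F) {c : K} (hc : c ≠ 0) (d : K) {i j : ι}
  (hi : b.IsPos i) (hj : b.IsPos j)

include hc hi hj

lemma spectralProd_one (h : P.pairing j i = 0) (h' : P.pairing i j = 0) :
    spectralProd b c d (alternate i j) (F ∘ alternatingRoot P i j) 2 =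
      spectralProd b c d (alternate j i) (F ∘ alternatingRoot P j i) 2 := by
  have hn := isDihedralType_one
  have h1 : P.pairing j i = (0 : ℤ) := by simp [h]
  have h2 : P.pairing i j = (0 : ℤ) := by simp [h']
  have hb := hn.heckeProd_eq h1 h2 hi hj hc d
  have e1 := hn.alternatingRoot_swap h1 h2 (k := 0) (by norm_num)
  have e2 := hn.alternatingRoot_swap h1 h2 (k := 1) (by norm_num)
  simp only [heckeProd, alternate, mul_one] at hb
  simp only [spectralProd, alternate, mul_one, Function.comp, e1, e2, spectralFactor, Nat.sub_zero,
    Nat.sub_self]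
  simp only [mul_add, add_mul, smul_mul_assoc, mul_smul_comm, hb, one_mul, mul_one]
  module

include hF

lemma spectralProd_two (h : P.pairing j i = -1) (h' : P.pairing i j = -1) :
    spectralProd b c d (alternate i j) (F ∘ alternatingRoot P i j) 3 =
      spectralProd b c d (alternate j i) (F ∘ alternatingRoot P j i) 3 := by
  have hn := isDihedralType_two
  have h1 : P.pairing j i = (-1 : ℤ) := by simp [h]
  have h2 : P.pairing i j = (-1 : ℤ) := by simp [h']
  have hb := hn.heckeProd_eq h1 h2 hi hj hc d
  have e0 := hn.alternatingRoot_swap h1 h2 (k := 0) (by norm_num)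
  have e1 := hn.alternatingRoot_swap h1 h2 (k := 1) (by norm_num)
  have e2 := hn.alternatingRoot_swap h1 h2 (k := 2) (by norm_num)
  have r := root_alternatingRoot h1 h2
  have hp (k : ℕ) (hk : k ≤ 2) := hn.isPos_alternatingRoot b h1 h2 hi hj hk
  have f0 : alternatingRoot P i j 0 = i := by simp [alternatingRoot, wordProd, alternate]
  have f2 : alternatingRoot P i j 2 = j := hn.alternatingRoot_last h1 h2
  have g1 := hF i j _ hi hj (hp 1 (by norm_num)) (by
    rw [r, show alternatingCoeff (-1) (-1) 1 = (1, 1) by decide]; module)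
  simp only [heckeProd, alternate, mul_one] at hb
  simp only [spectralProd, alternate, mul_one, Function.comp, e0, e1, e2, Nat.sub_zero,
    Nat.sub_self, Nat.reduceSub, f0, f2, g1]
  exact spectral_three (A := Module.End K (P.weylGroup →₀ K)) (heckeOp_mul_self b c d i)
    (heckeOp_mul_self b c d j) hb (F i) (F j)

lemma spectralProd_three (h : P.pairing j i = -2) (h' : P.pairing i j = -1) :
    spectralProd b c d (alternate i j) (F ∘ alternatingRoot P i j) 4 =
      spectralProd b c d (alternate j i) (F ∘ alternatingRoot P j i) 4 := by
  have hn := isDihedralType_three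
  have h1 : P.pairing j i = (-2 : ℤ) := by simp [h]
  have h2 : P.pairing i j = (-1 : ℤ) := by simp [h']
  have hb := hn.heckeProd_eq h1 h2 hi hj hc d
  have e0 := hn.alternatingRoot_swap h1 h2 (k := 0) (by norm_num)
  have e1 := hn.alternatingRoot_swap h1 h2 (k := 1) (by norm_num)
  have e2 := hn.alternatingRoot_swap h1 h2 (k := 2) (by norm_num)
  have e3 := hn.alternatingRoot_swap h1 h2 (k := 3) (by norm_num)
  have r := root_alternatingRoot h1 h2
  have hp (k : ℕ) (hk : k ≤ 3) := hn.isPos_alternatingRoot b h1 h2 hi hj hk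
  have f0 : alternatingRoot P i j 0 = i := by simp [alternatingRoot, wordProd, alternate]
  have f3 : alternatingRoot P i j 3 = j := hn.alternatingRoot_last h1 h2
  have g2 := hF i j _ hi hj (hp 2 (by norm_num)) (by
    rw [r, show alternatingCoeff (-2) (-1) 2 = (1, 1) by decide]; module)
  have g1 := hF i _ _ hi (hp 2 (by norm_num)) (hp 1 (by norm_num)) (by
    rw [r, r, show alternatingCoeff (-2) (-1) 2 = (1, 1) by decide,
      show alternatingCoeff (-2) (-1) 1 = (2, 1) by decide]; module)
  rw [g2, ← mul_assoc, ← sq] at g1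
  simp only [heckeProd, alternate, mul_one] at hb
  simp only [spectralProd, alternate, mul_one, Function.comp, e0, e1, e2, e3, Nat.sub_zero,
    Nat.sub_self, Nat.reduceSub, f0, f3, g1, g2]
  exact spectral_four (A := Module.End K (P.weylGroup →₀ K)) (heckeOp_mul_self b c d i)
    (heckeOp_mul_self b c d j) hb (F i) (F j)

/-- Multiplicativity concerns only sums of two positive roots, so the weights are found along the
chain α+β, 2α+β, 3α+β, 3α+2β, with α = α_i and β = α_j; each root is the previous one plus α or, at
the last step, plus β. -/
lemma spectralProd_five (h : P.pairing j i = -3) (h' : P.pairing i j = -1) :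
    spectralProd b c d (alternate i j) (F ∘ alternatingRoot P i j) 6 =
      spectralProd b c d (alternate j i) (F ∘ alternatingRoot P j i) 6 := by
  have hn := isDihedralType_five
  have h1 : P.pairing j i = (-3 : ℤ) := by simp [h]
  have h2 : P.pairing i j = (-1 : ℤ) := by simp [h']
  have hb := hn.heckeProd_eq h1 h2 hi hj hc d
  have e0 := hn.alternatingRoot_swap h1 h2 (k := 0) (by norm_num)
  have e1 := hn.alternatingRoot_swap h1 h2 (k := 1) (by norm_num)
  have e2 := hn.alternatingRoot_swap h1 h2 (k := 2) (by norm_num)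
  have e3 := hn.alternatingRoot_swap h1 h2 (k := 3) (by norm_num)
  have e4 := hn.alternatingRoot_swap h1 h2 (k := 4) (by norm_num)
  have e5 := hn.alternatingRoot_swap h1 h2 (k := 5) (by norm_num)
  have r := root_alternatingRoot h1 h2
  have hp (k : ℕ) (hk : k ≤ 5) := hn.isPos_alternatingRoot b h1 h2 hi hj hk
  have f0 : alternatingRoot P i j 0 = i := by simp [alternatingRoot, wordProd, alternate]
  have f5 : alternatingRoot P i j 5 = j := hn.alternatingRoot_last h1 h2
  have g4 := hF i j _ hi hj (hp 4 (by norm_num)) (by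
    rw [r, show alternatingCoeff (-3) (-1) 4 = (1, 1) by decide]; module)
  have g2 := hF i _ _ hi (hp 4 (by norm_num)) (hp 2 (by norm_num)) (by
    rw [r, r, show alternatingCoeff (-3) (-1) 4 = (1, 1) by decide,
      show alternatingCoeff (-3) (-1) 2 = (2, 1) by decide]; module)
  have g1 := hF i _ _ hi (hp 2 (by norm_num)) (hp 1 (by norm_num)) (by
    rw [r, r, show alternatingCoeff (-3) (-1) 2 = (2, 1) by decide,
      show alternatingCoeff (-3) (-1) 1 = (3, 1) by decide]; module)
  have g3 := hF _ j _ (hp 1 (by norm_num)) hj (hp 3 (by norm_num)) (by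
    rw [r, r, show alternatingCoeff (-3) (-1) 3 = (3, 2) by decide,
      show alternatingCoeff (-3) (-1) 1 = (3, 1) by decide]; module)
  replace g2 : F (alternatingRoot P i j 2) = F i ^ 2 * F j := by rw [g2, g4]; ring
  replace g1 : F (alternatingRoot P i j 1) = F i ^ 3 * F j := by rw [g1, g2]; ring
  replace g3 : F (alternatingRoot P i j 3) = F i ^ 3 * F j ^ 2 := by rw [g3, g1]; ring
  simp only [heckeProd, alternate, mul_one] at hb
  simp only [spectralProd, alternate, mul_one, Function.comp, e0, e1, e2, e3, e4, e5, Nat.sub_zero,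
    Nat.sub_self, Nat.reduceSub, f0, f5, g1, g2, g3, g4]
  exact spectral_six (A := Module.End K (P.weylGroup →₀ K)) (heckeOp_mul_self b c d i)
    (heckeOp_mul_self b c d j) hb (F i) (F j)

end RankTwo

/-! ### The Yang–Baxter equation for mixed Bruhat operators. -/

section MixedYangBaxter

variable {ι R M N : Type*} [Field R] [CharZero R] [AddCommGroup M] [Module R M]
  [AddCommGroup N] [Module R N] {P : RootPairing ι R M N} {b : P.Base}
  {K : Type*} [CommRing K]

lemma mixedBruhatProd_eq_prod_reverse (c d : K) (s : ℕ → ι) (e : ℕ → K) (n : ℕ) :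
    mixedBruhatProd b c d s e n = ((List.range n).map fun k =>
      mixedBruhatOp b c d (wordProd P s k • s k) (e k)).reverse.prod := by
  induction n with
  | zero => simp [mixedBruhatProd]
  | succ n ih => simp [mixedBruhatProd, List.range_succ, ih]

lemma map_range_eq_reverse {A : Type*} {f g : ℕ → A} {n : ℕ} (h : ∀ k ≤ n, g k = f (n - k)) :
    (List.range (n + 1)).map f = ((List.range (n + 1)).map g).reverse := by
  apply List.ext_getElem (by simp)
  intro k hk _
  simp only [List.length_map, List.length_range] at hk
  simp only [List.getElem_map, List.getElem_range, List.getElem_reverse, List.length_map,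
    List.length_range]
  rw [h _ (by omega)]
  congr 1
  omega

variable [P.IsReduced]

/-- Listing the positive roots from α_j reverses the list from α_i. Each order telescopes to a
translation times a spectral product; the translations agree since the word of length n + 1 is the
same from either end, and the spectral products agree by `hs`. -/
lemma IsDihedralType.mixedBruhat_reverse {z z' : ℤ} {n : ℕ} (hn : IsDihedralType z z' n)
    {i j : ι} (h : P.pairing j i = z) (h' : P.pairing i j = z') (hi : b.IsPos i) (hj : b.IsPos j)
    (hij : i ≠ j) {c d : K} {F : ι → K}
    (hs : spectralProd b c d (alternate i j) (F ∘ alternatingRoot P i j) (n + 1) =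
      spectralProd b c d (alternate j i) (F ∘ alternatingRoot P j i) (n + 1)) :
    (∀ k < orderOf (weylGroup.ofIdx P i * weylGroup.ofIdx P j),
      b.IsPos (alternatingRoot P i j k)) ∧
    ((List.range (orderOf (weylGroup.ofIdx P i * weylGroup.ofIdx P j))).map fun k =>
      mixedBruhatOp b c d (alternatingRoot P i j k) (F (alternatingRoot P i j k))).prod =
    ((List.range (orderOf (weylGroup.ofIdx P i * weylGroup.ofIdx P j))).map fun k =>
      mixedBruhatOp b c d (alternatingRoot P i j k) (F (alternatingRoot P i j k))).reverse.prod := by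
  rw [hn.orderOf_eq h h' hi hj hij]
  refine ⟨fun k hk => hn.isPos_alternatingRoot b h h' hi hj (by omega), ?_⟩
  have h3 := map_range_eq_reverse (n := n)
    (f := fun k => mixedBruhatOp b c d (alternatingRoot P i j k) (F (alternatingRoot P i j k)))
    (g := fun k => mixedBruhatOp b c d (alternatingRoot P j i k) (F (alternatingRoot P j i k)))
    (fun k hk => by rw [hn.alternatingRoot_swap h h' hk])
  have h1 := mixedBruhatProd_eq_prod_reverse (b := b) c d (alternate i j)
    (F ∘ alternatingRoot P i j) (n + 1)
  have h2 := mixedBruhatProd_eq_prod_reverse (b := b) c d (alternate j i)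
    (F ∘ alternatingRoot P j i) (n + 1)
  rw [mixedBruhatProd_eq, hs, wordProd_alternate_eq (hn.alternatingRoot_last h h'),
    ← mixedBruhatProd_eq] at h1
  exact (congrArg List.prod h3).trans (h2.symm.trans h1)

/-- The mixed Bruhat operators with multiplicative weights satisfy the Yang--Baxter equation of
two positive roots at a non-acute angle. -/
theorem mixedBruhat_yangBaxter [IsDomain K] [P.IsRootSystem] [Finite ι] [P.IsCrystallographic]
    {F : ι → K} (hF : IsMultiplicativeOn b F) {c : K} (hc : c ≠ 0) (d : K) {i j : ι}
    (hi : b.IsPos i) (hj : b.IsPos j) (hij : i ≠ j) (hle : P.pairingIn ℤ i j ≤ 0) :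
    (∀ k < orderOf (weylGroup.ofIdx P i * weylGroup.ofIdx P j),
      b.IsPos (alternatingRoot P i j k)) ∧
    ((List.range (orderOf (weylGroup.ofIdx P i * weylGroup.ofIdx P j))).map fun k =>
      mixedBruhatOp b c d (alternatingRoot P i j k) (F (alternatingRoot P i j k))).prod =
    ((List.range (orderOf (weylGroup.ofIdx P i * weylGroup.ofIdx P j))).map fun k =>
      mixedBruhatOp b c d (alternatingRoot P i j k) (F (alternatingRoot P i j k))).reverse.prod := by
  have hne : P.root i ≠ P.root j := fun h => hij (P.root.injective h)
  have hneg : P.root i ≠ -P.root j := fun h => (isPos_iff_not_of_root_eq_neg b h).mp hi hj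
  have hm := P.pairingIn_pairingIn_mem_set_of_isCrystal_of_isRed' i j hne hneg
  have e1 : P.pairing i j = (P.pairingIn ℤ i j : R) := (P.algebraMap_pairingIn ℤ i j).symm
  have e2 : P.pairing j i = (P.pairingIn ℤ j i : R) := (P.algebraMap_pairingIn ℤ j i).symm
  generalize P.pairingIn ℤ i j = z at *
  generalize P.pairingIn ℤ j i = z' at *
  simp only [Set.mem_insert_iff, Set.mem_singleton_iff, Prod.mk.injEq] at hm
  rcases hm with ⟨rfl, rfl⟩ | ⟨rfl, rfl⟩ | ⟨rfl, rfl⟩ | ⟨rfl, rfl⟩ | ⟨rfl, rfl⟩ | ⟨rfl, rfl⟩ |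
    ⟨rfl, rfl⟩ | ⟨rfl, rfl⟩ | ⟨rfl, rfl⟩ | ⟨rfl, rfl⟩ | ⟨rfl, rfl⟩ <;> try omega
  · exact isDihedralType_one.mixedBruhat_reverse e2 e1 hi hj hij
      (spectralProd_one hc d hi hj (by simp [e2]) (by simp [e1]))
  · exact isDihedralType_two.mixedBruhat_reverse e2 e1 hi hj hij
      (spectralProd_two hF hc d hi hj (by simp [e2]) (by simp [e1]))
  · exact isDihedralType_three.mixedBruhat_reverse e2 e1 hi hj hij
      (spectralProd_three hF hc d hi hj (by simp [e2]) (by simp [e1]))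
  -- Here the long and short roots are interchanged, so the spectral identity is taken for (j, i)
  -- and read backwards.
  · exact isDihedralType_three'.mixedBruhat_reverse e2 e1 hi hj hij
      (spectralProd_three hF hc d hj hi (by simp [e1]) (by simp [e2])).symm
  · exact isDihedralType_five.mixedBruhat_reverse e2 e1 hi hj hij
      (spectralProd_five hF hc d hi hj (by simp [e2]) (by simp [e1]))
  · exact isDihedralType_five'.mixedBruhat_reverse e2 e1 hi hj hij
      (spectralProd_five hF hc d hj hi (by simp [e1]) (by simp [e2])).symm

end MixedYangBaxter

/-! ### Canonical generators pair non-positively. -/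

section CanonicalGenerators

variable {ι R M N : Type*} [Field R] [CharZero R] [AddCommGroup M] [Module R M]
  [AddCommGroup N] [Module R N] {P : RootPairing ι R M N} {b : P.Base}
  {W' : Subgroup P.weylGroup} {i j : ι}

/-- If the pairing were 1, then s_j α_i = α_i - α_j would be a root whose reflection lies in `W'`.
It or its negative is positive, which decomposes α_i or α_j. -/
lemma pairing_ne_one_of_indecomposable (hi : i ∈ positiveSubsystem b W')
    (hj : j ∈ positiveSubsystem b W')
    (hi' : ∀ k ∈ positiveSubsystem b W', P.root i ≠ P.root j + P.root k)
    (hj' : ∀ k ∈ positiveSubsystem b W', P.root j ≠ P.root i + P.root k) :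
    P.pairing i j ≠ 1 := by
  intro h
  set l := weylGroup.ofIdx P j • i with hl
  have hr : P.root l = P.root i - P.root j := by rw [hl, ofIdx_smul_root, h, one_smul]
  have hm : weylGroup.ofIdx P l ∈ W' := by
    rw [hl, ofIdx_smul_eq_conj]
    exact mul_mem (mul_mem hj.2 hi.2) (inv_mem hj.2)
  by_cases hp : b.IsPos l
  · exact hi' l ⟨hp, hm⟩ (by rw [hr]; abel)
  · have hr' : P.root (weylGroup.ofIdx P l • l) = -P.root l := by
      rw [ofIdx_smul_root, pairing_same]; module
    refine hj' (weylGroup.ofIdx P l • l) ⟨?_, ?_⟩ (by rw [hr', hr]; abel)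
    · rwa [isPos_iff_not_of_root_eq_neg b hr']
    · rw [ofIdx_smul_eq_conj]
      simpa using hm

/-- For non-proportional roots with positive pairings, one of the two pairings equals 1. -/
lemma pairingIn_nonpos_of_indecomposable [Finite ι] [P.IsCrystallographic] [P.IsReduced]
    (hij : i ≠ j) (hi : i ∈ positiveSubsystem b W') (hj : j ∈ positiveSubsystem b W')
    (hi' : ∀ k ∈ positiveSubsystem b W', P.root i ≠ P.root j + P.root k)
    (hj' : ∀ k ∈ positiveSubsystem b W', P.root j ≠ P.root i + P.root k) :
    P.pairingIn ℤ i j ≤ 0 := by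
  have hne : P.root i ≠ P.root j := fun h => hij (P.root.injective h)
  have hneg : P.root i ≠ -P.root j := fun h => (isPos_iff_not_of_root_eq_neg b h).mp hi.1 hj.1
  have hm := P.pairingIn_pairingIn_mem_set_of_isCrystal_of_isRed' i j hne hneg
  have h1 := pairing_ne_one_of_indecomposable hi hj hi' hj'
  have h2 := pairing_ne_one_of_indecomposable hj hi hj' hi'
  rw [← P.algebraMap_pairingIn ℤ, algebraMap_int_eq, eq_intCast, ne_eq, Int.cast_eq_one] at h1 h2
  simp only [Set.mem_insert_iff, Set.mem_singleton_iff, Prod.mk.injEq] at hm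
  omega

lemma IsDihedralWithGenerators.exists_index [Finite ι] [P.IsCrystallographic] [P.IsReduced]
    {x y : P.weylGroup} (h : IsDihedralWithGenerators b W' x y) :
    ∃ i j, b.IsPos i ∧ b.IsPos j ∧ i ≠ j ∧ P.pairingIn ℤ i j ≤ 0 ∧
      weylGroup.ofIdx P i = x ∧ weylGroup.ofIdx P j = y := by
  obtain ⟨-, hxy, hc⟩ := h
  obtain ⟨i, ⟨hi, hi'⟩, rfl⟩ : x ∈ canonicalGenerators b W' := by rw [hc]; simp
  obtain ⟨j, ⟨hj, hj'⟩, rfl⟩ : y ∈ canonicalGenerators b W' := by rw [hc]; simp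
  have hij : i ≠ j := fun h => hxy (by rw [h])
  exact ⟨i, j, hi.1, hj.1, hij,
    pairingIn_nonpos_of_indecomposable hij hi hj (hi' j hj) (hj' i hi), rfl, rfl⟩

end CanonicalGenerators

/-! ### Ordered products and intertwining maps. -/

section Products

variable {κ K V : Type*} [CommRing K] [AddCommGroup V] [Module K V]

lemma prod_map_mul_comm {A : Type*} [Monoid A] {f g : κ → A} {x : A} {L : List κ}
    (h : ∀ k ∈ L, f k * x = x * g k) : (L.map f).prod * x = x * (L.map g).prod := by
  induction L with
  | nil => simp
  | cons k L ih =>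
    rw [List.map_cons, List.prod_cons, List.map_cons, List.prod_cons, mul_assoc,
      ih fun l hl => h l (by simp [hl]), ← mul_assoc, h k (by simp), mul_assoc]

lemma prod_map_smul_eq (x : K) (f : κ → Module.End K V) (L : List κ) :
    (L.map fun k => x • f k).prod = x ^ L.length • (L.map f).prod := by
  induction L with
  | nil => simp
  | cons k L ih => simp [ih, pow_succ', smul_smul, mul_comm]

lemma map_prod_apply {K' V' : Type*} [CommRing K'] [AddCommGroup V'] [Module K' V']
    (φ : V →+ V') {f : κ → Module.End K V} {g : κ → Module.End K' V'} {L : List κ}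
    (h : ∀ k ∈ L, ∀ v, φ (f k v) = g k (φ v)) (v : V) :
    φ ((L.map f).prod v) = (L.map g).prod (φ v) := by
  induction L with
  | nil => simp
  | cons k L ih =>
    simp only [List.map_cons, List.prod_cons, Module.End.mul_apply]
    rw [h k (by simp), ih fun l hl => h l (by simp [hl])]

end Products

/-! ### Deformation over k[t] and specialization at t = 0. -/

section Degeneration

open Polynomial

variable {ι R M N : Type*} [Field R] [AddCommGroup M] [Module R M]
  [AddCommGroup N] [Module R N] {P : RootPairing ι R M N} {k : Type*} [Field k]

variable (P k) in
/-- Specialization at `t = 0`. -/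
def specialize : (P.weylGroup →₀ k[X]) →+ MonoidAlgebra k P.weylGroup :=
  Finsupp.liftAddHom fun w =>
    (MonoidAlgebra.singleAddHom w).comp (evalRingHom (0 : k)).toAddMonoidHom

lemma specialize_single (w : P.weylGroup) (f : k[X]) :
    specialize P k (Finsupp.single w f) = MonoidAlgebra.single w (f.eval 0) := by
  simp [specialize]

variable (b : P.Base)

/-- The operator `w ↦ t ^ ℓ(w) w`. -/
def lengthScaling : Module.End k[X] (P.weylGroup →₀ k[X]) :=
  weightedTranslation 1 fun w => X ^ length b w

lemma lengthScaling_single (w : P.weylGroup) :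
    lengthScaling b (Finsupp.single w (1 : k[X])) =
      (X : k[X]) ^ length b w • Finsupp.single w 1 := by
  simp [lengthScaling]

lemma eq_of_mul_lengthScaling {f g : Module.End k[X] (P.weylGroup →₀ k[X])}
    (h : f * lengthScaling b = g * lengthScaling b) : f = g := by
  refine end_ext_single fun w => ?_
  have hw := LinearMap.congr_fun h (Finsupp.single w 1)
  rw [Module.End.mul_apply, Module.End.mul_apply, lengthScaling_single, map_smul, map_smul] at hw
  exact smul_right_injective _ (pow_ne_zero _ X_ne_zero) hw

variable [CharZero R] (E : {i : ι // b.IsPos i} → k) (ε : k)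

open Classical in
/-- The weight `E(α) t ^ (2 ht α)` deforming `E`, extended by zero to the negative roots. -/
def deformedWeight (i : ι) : k[X] :=
  if h : b.IsPos i then C (E ⟨i, h⟩) * X ^ (2 * b.height i).toNat else 0

lemma isMultiplicativeOn_deformedWeight {E : {i : ι // b.IsPos i} → k}
    (hE : IsMultiplicative b E) : IsMultiplicativeOn b (deformedWeight b E) := by
  intro i j l hi hj hl h
  have ht := b.height_add h
  have e : (2 * b.height l).toNat = (2 * b.height i).toNat + (2 * b.height j).toNat := by
    rw [Base.isPos_iff] at hi hj
    omega
  simp only [deformedWeight, hi, hj, hl, dif_pos, hE ⟨i, hi⟩ ⟨j, hj⟩ ⟨l, hl⟩ h, e, C_mul, pow_add]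
  ring

lemma deformedWeight_of_isPos {i : ι} (hi : b.IsPos i) :
    deformedWeight b E i = C (E ⟨i, hi⟩) * X ^ (2 * b.height i).toNat := by
  simp [deformedWeight, hi]

lemma eval_deformedWeight {i : ι} (hi : b.IsPos i) : (deformedWeight b E i).eval 0 = 0 := by
  rw [deformedWeight_of_isPos b E hi]
  rw [Base.isPos_iff] at hi
  have : (2 * b.height i).toNat ≠ 0 := by omega
  simp [this]

open Classical in
/-- The coefficient of `s_i w` in the image of `w` under the deformed quantum Bruhat operator. -/
def deformedCoeff (i : ι) (w : P.weylGroup) : k[X] :=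
  if h : b.IsPos i then
    if b.IsPos (w⁻¹ • i) then X ^ (length b (weylGroup.ofIdx P i * w) - length b w - 1)
    else C (E ⟨i, h⟩) * X ^ ((2 * b.height i).toNat + length b (weylGroup.ofIdx P i * w)
      - length b w - 1)
  else 0

/-- A deformation over `k[t]` of `1 + ε Q_τ`. -/
def deformedOp (i : ι) : Module.End k[X] (P.weylGroup →₀ k[X]) :=
  (1 - deformedWeight b E i) • 1 +
    weightedTranslation (weylGroup.ofIdx P i) fun w => C ε * deformedCoeff b E i w

lemma deformedOp_single (i : ι) (w : P.weylGroup) :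
    deformedOp b E ε i (Finsupp.single w 1) = (1 - deformedWeight b E i) • Finsupp.single w 1 +
      (C ε * deformedCoeff b E i w) • Finsupp.single (weylGroup.ofIdx P i * w) 1 := by
  simp only [deformedOp, LinearMap.add_apply, LinearMap.smul_apply, Module.End.one_apply,
    weightedTranslation_single, one_mul, Finsupp.smul_single, smul_eq_mul, mul_one]

variable [Finite ι] [P.IsCrystallographic] [P.IsReduced]

/-- This makes the truncated subtraction in the second branch of `deformedCoeff` exact. -/
lemma length_lt_height_add {i : ι} (hi : b.IsPos i) (w : P.weylGroup) :
    length b w + 1 ≤ (2 * b.height i).toNat + length b (weylGroup.ofIdx P i * w) := by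
  have h1 := length_ofIdx_le b hi
  have h2 := length_mul_le b (weylGroup.ofIdx P i) (weylGroup.ofIdx P i * w)
  rw [ofIdx_mul_cancel] at h2
  omega

lemma smul_deformedOp_mul_lengthScaling {i : ι} (hi : b.IsPos i) :
    ((X : k[X]) • deformedOp b E ε i) * lengthScaling b =
      lengthScaling b * mixedBruhatOp b X (C ε) i (deformedWeight b E i) := by
  refine end_ext_single fun w => ?_
  rw [Module.End.mul_apply, Module.End.mul_apply, lengthScaling_single, map_smul,
    LinearMap.smul_apply, deformedOp_single, mixedBruhatOp_single, map_add, map_smul, map_smul,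
    lengthScaling_single, lengthScaling_single]
  by_cases hw : b.IsPos (w⁻¹ • i)
  · have hl := lt_length_ofIdx_mul b hi hw
    obtain ⟨r, hr⟩ := Nat.exists_eq_add_of_lt hl
    have e : length b w + r + 1 - length b w - 1 = r := by omega
    simp only [deformedCoeff, hi, hw, dif_pos, if_true, hr, e]
    match_scalars <;> ring
  · obtain ⟨r, hr⟩ := Nat.exists_eq_add_of_le (length_lt_height_add b hi w)
    have e : (2 * b.height i).toNat + length b (weylGroup.ofIdx P i * w) - length b w - 1 = r := by
      omega
    have hX : (X : k[X]) ^ (2 * b.height i).toNat * X ^ length b (weylGroup.ofIdx P i * w) =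
        X ^ length b w * X * X ^ r := by
      rw [← pow_add, hr]; ring
    simp only [deformedCoeff, hi, hw, dif_pos, if_false, e, deformedWeight_of_isPos b E hi]
    match_scalars
    · ring
    · linear_combination (-C ε * C (E ⟨i, hi⟩)) * hX

/-- Evaluation at 0 keeps only exponent zero. When w⁻¹ α < 0 this means ℓ(w) - ℓ(τw) = 2 ht α - 1;
as ℓ(w) - ℓ(τw) ≤ ℓ(τ) ≤ 2 ht α - 1, both inequalities are then equalities, which is the quantum
condition. -/
lemma eval_deformedCoeff (τ : reflections b) (w : P.weylGroup) :
    (deformedCoeff b E (posRoot b τ).1 w).eval 0 = quantumBruhatCoeff b E τ w := by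
  have hi := (posRoot b τ).2
  have hl := length_lt_height_add b hi w
  have hτ := length_ofIdx_le b hi
  have hm := length_mul_le b (weylGroup.ofIdx P (posRoot b τ).1)
    (weylGroup.ofIdx P (posRoot b τ).1 * w)
  rw [ofIdx_mul_cancel] at hm
  by_cases hw : b.IsPos (w⁻¹ • (posRoot b τ).1)
  · have hlt := lt_length_ofIdx_mul b hi hw
    rw [ofIdx_posRoot] at hlt
    simp only [deformedCoeff, hi, hw, dif_pos, if_true, eval_pow, eval_X, quantumBruhatCoeff,
      ofIdx_posRoot]
    by_cases h : length b (τ * w) = length b w + 1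
    · simp [h]
    · rw [if_neg h, if_neg (by omega), zero_pow (by omega)]
  · have hlt := length_ofIdx_mul_lt b hi hw
    rw [ofIdx_posRoot] at hlt hl hτ hm
    simp only [deformedCoeff, hi, hw, dif_pos, if_false, eval_mul, eval_C, eval_pow, eval_X,
      quantumBruhatCoeff, ofIdx_posRoot]
    rw [if_neg (by omega)]
    by_cases h : length b (τ * w) + length b (τ : P.weylGroup) = length b w ∧
        (length b (τ : P.weylGroup) : ℤ) = 2 * b.height (posRoot b τ).1 - 1
    · rw [if_pos h, show (2 * b.height (posRoot b τ).1).toNat + length b (τ * w) - length b w - 1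
        = 0 by omega]
      simp
    · rw [if_neg h, zero_pow, mul_zero]
      omega

lemma specialize_deformedOp (τ : reflections b) (v : P.weylGroup →₀ k[X]) :
    specialize P k (deformedOp b E ε (posRoot b τ).1 v) =
      (1 + ε • quantumBruhat b E τ) (specialize P k v) := by
  induction v using Finsupp.induction_linear with
  | zero => simp
  | add f g hf hg => simp only [map_add, hf, hg]
  | single w f =>
    have e : MonoidAlgebra.single w (f.eval 0) =
        f.eval 0 • (MonoidAlgebra.single w 1 : MonoidAlgebra k P.weylGroup) := by simp
    rw [specialize_single, e, map_smul, LinearMap.add_apply, LinearMap.smul_apply,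
      quantumBruhat_single, ← eval_deformedCoeff]
    simp only [deformedOp, LinearMap.add_apply, LinearMap.smul_apply, Module.End.one_apply,
      weightedTranslation_single, Finsupp.smul_single, smul_eq_mul, map_add, specialize_single,
      eval_mul, eval_sub, eval_one, eval_C, eval_deformedWeight b E (posRoot b τ).2, sub_zero,
      one_mul, MonoidAlgebra.smul_single, mul_one, smul_add, ofIdx_posRoot]

/-- The operators `1 + ε Q_τ` satisfy the Yang--Baxter equations. -/
theorem isYangBaxterSolution_quantumBruhat [P.IsRootSystem] (hE : IsMultiplicative b E) :
    IsYangBaxterSolution b fun τ =>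
      (1 : Module.End k (MonoidAlgebra k P.weylGroup)) + ε • quantumBruhat b E τ := by
  intro W' x y hW
  obtain ⟨i, j, hi, hj, hij, hle, hx, hy⟩ := hW.exists_index
  obtain ⟨hpos, hyb⟩ := mixedBruhat_yangBaxter (isMultiplicativeOn_deformedWeight b hE)
    (X_ne_zero (R := k)) (C ε) hi hj hij hle
  set L := List.range (orderOf (weylGroup.ofIdx P i * weylGroup.ofIdx P j)) with hL
  set γ := alternatingRoot P i j with hγ
  set r : reflections b → Module.End k (MonoidAlgebra k P.weylGroup) :=
    fun τ => 1 + ε • quantumBruhat b E τ with hr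
  have hscale (l : List ℕ) (hl : ∀ n ∈ l, n ∈ L) :
      (X : k[X]) ^ l.length • (l.map fun n => deformedOp b E ε (γ n)).prod * lengthScaling b =
        lengthScaling b * (l.map fun n => mixedBruhatOp b X (C ε) (γ n)
          (deformedWeight b E (γ n))).prod := by
    rw [← prod_map_smul_eq]
    exact prod_map_mul_comm fun n hn => smul_deformedOp_mul_lengthScaling b E ε
      (hpos n (List.mem_range.mp (hl n hn)))
  have hdef : (L.map fun n => deformedOp b E ε (γ n)).prod =
      (L.reverse.map fun n => deformedOp b E ε (γ n)).prod := by
    have h1 := hscale L fun _ h => h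
    have h2 := hscale L.reverse fun _ h => List.mem_reverse.mp h
    rw [← List.map_reverse] at hyb
    rw [hyb, ← h2, List.length_reverse] at h1
    -- Both orders have the same number of factors, hence the same power of t, which cancels along
    -- with the length scaling.
    exact smul_right_injective _ (pow_ne_zero _ X_ne_zero) (eq_of_mul_lengthScaling b h1)
  have hspec (l : List ℕ) (hl : ∀ n ∈ l, n ∈ L) (v : P.weylGroup →₀ k[X]) :
      specialize P k ((l.map fun n => deformedOp b E ε (γ n)).prod v) =
        (l.map fun n => r ⟨_, alternating_mem_reflections b x.2 y.2 n⟩).prod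
          (specialize P k v) := by
    refine map_prod_apply _ (fun n hn v => ?_) v
    -- The root γ n is positive with reflection (xy)ⁿx, so uniqueness identifies it with the chosen
    -- `posRoot`.
    rw [hr, ← specialize_deformedOp, posRoot_eq b _ (hpos n (List.mem_range.mp (hl n hn)))]
    rw [ofIdx_alternatingRoot, hx, hy]
  have hfinal : (L.map fun n => r ⟨_, alternating_mem_reflections b x.2 y.2 n⟩).prod =
      (L.reverse.map fun n => r ⟨_, alternating_mem_reflections b x.2 y.2 n⟩).prod := by
    -- It is enough to compare on group elements, each of which is the specialization of the
    -- corresponding basis vector over k[t].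
    refine MonoidAlgebra.lhom_ext' fun w => LinearMap.ext_ring ?_
    have h1 := hspec L (fun _ h => h) (Finsupp.single w 1)
    have h2 := hspec L.reverse (fun _ h => List.mem_reverse.mp h) (Finsupp.single w 1)
    rw [hdef, h2, specialize_single, eval_one] at h1
    exact h1.symm
  rw [hL, hx, hy] at hfinal
  rw [reflectionSequence, ← List.map_reverse, ← List.map_reverse, List.map_map, List.map_map]
  exact hfinal

end Degeneration

end QuantumBruhat

theorem corollary4p1 {ι V V' : Type*} [Finite ι]
    [AddCommGroup V] [Module ℝ V] [AddCommGroup V'] [Module ℝ V']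
    (P : RootPairing ι ℝ V V') [P.IsRootSystem] [P.IsCrystallographic] [P.IsReduced]
    (b : P.Base) {k : Type*} [Field k] [CharZero k]
    (E : {i : ι // b.IsPos i} → k) (hE : QuantumBruhat.IsMultiplicative b E) (ε : k) :
    QuantumBruhat.IsYangBaxterSolution b
      (fun τ => (1 : Module.End k (MonoidAlgebra k P.weylGroup)) +
        ε • QuantumBruhat.quantumBruhat b E τ) :=
  QuantumBruhat.isYangBaxterSolution_quantumBruhat b E ε hE

end
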